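/- A garden-hose game of size $s\in\mathbb N$ on inputs from $\{0,1\}^n\times\{0,1\}^n$ consists of vertex sets $A_\circ=\{0,1^A,\dots,s^A\}$ and $B=\{1^B,\dots,s^B\}$, the edges $\{i^A,i^B\}$ for $1\le i\le s$ (the pipes), and two functions that assign to each $x\in\{0,1\}^n$ a set $E_{A_\circ}(x)$ of edges on $A_\circ$ and to each $y\in\{0,1\}^n$ a set $E_B(y)$ of edges on $B$, each forming a graph without loops of maximum degree at most $1$. Let $G(x,y)$ be the graph on $A_\circ\cup B$ with all these edges. The game computes $f:\{0,1\}^n\times\{0,1\}^n\to\{0,1\}$ if, for all $x,y$, the (unique) maximal path in $G(x,y)$ that starts at $0$ ends in $A_\circ$ when $f(x,y)=0$ and in $B$ when $f(x,y)=1$. The garden-hose complexity $\mathrm{gh}(f)$ is the least size of a game that computes $f$. A family $g=(g_m)_{m\in\mathbb N}$ of functions $g_m:\{0,1\}^m\times\{0,1\}^m\to\{0,1\}$ is log-space computable if there are a constant $c$ and a single deterministic Turing machine, with a read-only input tape and finitely many work tapes, that for all $m$ and all $x,y\in\{0,1\}^m$ halts with output $g_m(x,y)$ on the input $xy$ of length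 $2m$, and, if $m\ge 1$, visits at most $c\log_2(2m)$ locations of its work tapes. Let $f=(f_n)_{n\in\mathbb N}$ be a family of functions $f_n:\{0,1\}^n\times\{0,1\}^n\to\{0,1\}$. If $\mathrm{gh}(f_n)$ is bounded by a polynomial in $n$, then $f$ is log-space computable up to local pre-processing: there are a function $m:\mathbb N\to\mathbb N$ bounded by a polynomial, a log-space computable family $g=(g_k)_{k\in\mathbb N}$, and for each $n$ functions $\alpha_n,\beta_n:\{0,1\}^n\to\{0,1\}^{m(n)}$ such that $$f_n(x,y)=g_{m(n)}(\alpha_n(x),\beta_n(y))\qquad\text{for all } n \text{ and all } x,y\in\{0,1\}^n.$$ -/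

import Mathlib

/-- The set `{0,1}^n`. -/
abbrev Bits (n : ℕ) : Type := Fin n → Bool

/-! ### The garden-hose game -/

/-- A garden-hose game with `s` pipes on inputs from `{0,1}^n × {0,1}^n`. Alice's vertex set `A_∘`
is `Option (Fin s)`, with `none` the water tap; Bob's vertex set `B` is `Fin s`.
Each player picks a graph of maximum degree at most one, depending on the own input only. -/
structure GardenHoseGame (n s : ℕ) where
  /-- Alice's connections among the tap and the pipe ends on her side. -/
  alice : Bits n → SimpleGraph (Option (Fin s))
  /-- Bob's connections among the pipe ends on his side. -/
  bob : Bits n → SimpleGraph (Fin s)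
  alice_unique : ∀ x u v w, (alice x).Adj u v → (alice x).Adj u w → v = w
  bob_unique : ∀ y u v w, (bob y).Adj u v → (bob y).Adj u w → v = w

namespace GardenHoseGame

/-- The pipes: the `i`-th vertex on Alice's side is joined to the `i`-th one on Bob's side. -/
def pipes (s : ℕ) : SimpleGraph (Option (Fin s) ⊕ Fin s) :=
  SimpleGraph.fromEdgeSet {e | ∃ i : Fin s, e = s(Sum.inl (some i), Sum.inr i)}

/-- The graph `G(x,y)` on `A_∘ ∪ B`: the pipes with the connections of Alice and Bob. -/
def graph {n s : ℕ} (G : GardenHoseGame n s) (x y : Bits n) :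
    SimpleGraph (Option (Fin s) ⊕ Fin s) :=
  pipes s ⊔ (G.alice x).map Function.Embedding.inl ⊔ (G.bob y).map Function.Embedding.inr

/-- The water tap. -/
abbrev tap (s : ℕ) : Option (Fin s) ⊕ Fin s := Sum.inl none

/-- `v` is the endpoint of a maximal path of `G(x,y)` that starts at the tap: no further vertex
can be appended to the path. -/
def IsEndpoint {n s : ℕ} (G : GardenHoseGame n s) (x y : Bits n)
    (v : Option (Fin s) ⊕ Fin s) : Prop :=
  ∃ p : (G.graph x y).Walk (tap s) v, p.IsPath ∧ ∀ w, (G.graph x y).Adj v w → w ∈ p.support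

/-- The game computes `f`: the water comes out on Alice's side if `f(x,y) = 0` and on Bob's side
if `f(x,y) = 1`. -/
def Computes {n s : ℕ} (G : GardenHoseGame n s) (f : Bits n → Bits n → Bool) : Prop :=
  ∀ x y, ∃ v, G.IsEndpoint x y v ∧
    (f x y = false → v.isLeft = true) ∧ (f x y = true → v.isRight = true)

end GardenHoseGame

/-- The garden-hose complexity: the least number of pipes of a game that computes `f`
(the value would be `⊤` if there were no such game). -/
noncomputable def gardenHoseComplexity {n : ℕ} (f : Bits n → Bits n → Bool) : ℕ∞ :=
  sInf {t : ℕ∞ | ∃ (s : ℕ) (G : GardenHoseGame n s), G.Computes f ∧ t = (s : ℕ∞)}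

/-! ### Turing machines with a read-only input tape and work tapes -/

/-- What the input head can read: a bit of the input or one of the two end markers. -/
inductive InputSymbol : Type
  | leftEnd
  | rightEnd
  | bit (b : Bool)

/-- Head movements. -/
inductive HeadMove : Type
  | left
  | stay
  | right

/-- A deterministic Turing machine with a read-only two-way input tape and `numTapes` work tapes,
infinite in both directions, that answers by accepting or rejecting. -/
structure OfflineTM where
  /-- The number of work tapes. -/
  numTapes : ℕ
  /-- The states. -/
  State : Type
  /-- The work alphabet. -/
  Sym : Type
  [finState : Finite State]
  [decState : DecidableEq State]
  [finSym : Finite Sym]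
  blank : Sym
  start : State
  accept : State
  reject : State
  accept_ne_reject : accept ≠ reject
  /-- From the state, the scanned input symbol and the scanned work symbols, the new state, the
  movement of the input head, and for each work tape the symbol written and the movement. -/
  trans : State → InputSymbol → (Fin numTapes → Sym) →
    State × HeadMove × (Fin numTapes → Sym × HeadMove)

namespace OfflineTM

attribute [instance] finState decState finSym

/-- The input tape holds the left end marker at position `0`, the input `w` at the positions
`1, …, w.length`, and the right end marker at position `w.length + 1`. -/
def readInput (w : List Bool) : ℕ → InputSymbol
  | 0 => InputSymbol.leftEnd
  | i + 1 =>
    match w[i]? with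
    | some b => InputSymbol.bit b
    | none => InputSymbol.rightEnd

/-- Movement of the input head on an input of length `N`: it never leaves the end markers. -/
def moveInput (N pos : ℕ) : HeadMove → ℕ
  | HeadMove.left => pos - 1
  | HeadMove.stay => pos
  | HeadMove.right => min (pos + 1) (N + 1)

/-- Movement of a work head. -/
def moveWork (pos : ℤ) : HeadMove → ℤ
  | HeadMove.left => pos - 1
  | HeadMove.stay => pos
  | HeadMove.right => pos + 1

/-- A configuration, without the content of the input tape. -/
structure Cfg (M : OfflineTM) where
  state : M.State
  inputPos : ℕ
  workPos : Fin M.numTapes → ℤ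
  work : Fin M.numTapes → ℤ → M.Sym

/-- The initial configuration: blank work tapes, input head on the first input position. -/
def init (M : OfflineTM) : M.Cfg where
  state := M.start
  inputPos := 1
  workPos := fun _ => 0
  work := fun _ _ => M.blank

/-- One step on input `w`; `none` if the machine has halted. -/
def step (M : OfflineTM) (w : List Bool) (c : M.Cfg) : Option M.Cfg :=
  if c.state = M.accept ∨ c.state = M.reject then none
  else
    let r := M.trans c.state (readInput w c.inputPos) (fun t => c.work t (c.workPos t))
    some
      { state := r.1
        inputPos := moveInput w.length c.inputPos r.2.1
        workPos := fun t => moveWork (c.workPos t) (r.2.2 t).2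
        work := fun t => Function.update (c.work t) (c.workPos t) (r.2.2 t).1 }

/-- On input `w` the machine halts with output `b` (accepting means `1`, rejecting means `0`). -/
def Outputs (M : OfflineTM) (w : List Bool) (b : Bool) : Prop :=
  ∃ c, StateTransition.Reaches (M.step w) M.init c ∧ c.state = if b then M.accept else M.reject

/-- The work tape locations (tape, cell) visited during the computation on input `w`. -/
def visited (M : OfflineTM) (w : List Bool) : Set (Fin M.numTapes × ℤ) :=
  {q | ∃ c, StateTransition.Reaches (M.step w) M.init c ∧ c.workPos q.1 = q.2}

end OfflineTM

/-- The family `g_m : {0,1}^m × {0,1}^m → {0,1}` is log-space computable: one machine outputs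
`g_m(x,y)` on every input `xy`, visiting at most `c log N` work tape locations on inputs of
length `N = 2m`. (The bound is asked for `N ≥ 2` because `log N` is undefined or zero below; the
machine halts on the finitely many shorter inputs, so the number of locations is bounded there.) -/
def LogSpaceComputable (g : ∀ m : ℕ, Bits m → Bits m → Bool) : Prop :=
  ∃ (M : OfflineTM) (c : ℕ), ∀ (m : ℕ) (x y : Bits m),
    M.Outputs (List.ofFn x ++ List.ofFn y) (g m x y) ∧
      (2 ≤ 2 * m →
        (M.visited (List.ofFn x ++ List.ofFn y)).encard ≤ ((c * Nat.log 2 (2 * m) : ℕ) : ℕ∞))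

/-! ### Local pre-processing -/

/-- `f` is obtained from `g` by local pre-processing. -/
def ObtainedByLocalPreprocessing {n m : ℕ} (f : Bits n → Bits n → Bool)
    (g : Bits m → Bits m → Bool) : Prop :=
  ∃ α β : Bits n → Bits m, ∀ x y, f x y = g (α x) (β y)

/-- The family `f` is log-space computable up to local pre-processing: each `f_n` is obtained by
local pre-processing from the member `g_{m(n)}` of a log-space computable family `g`, where `m(n)`
is polynomially bounded in `n`. -/
def LogSpaceUpToLocalPreprocessing (f : ∀ n : ℕ, Bits n → Bits n → Bool) : Prop :=
  ∃ (m : ℕ → ℕ) (g : ∀ k : ℕ, Bits k → Bits k → Bool),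
    (∃ q : Polynomial ℕ, ∀ n, m n ≤ q.eval n) ∧
      LogSpaceComputable g ∧
      ∀ n, ObtainedByLocalPreprocessing (f n) (g (m n))

/-!
Follow the water two edges at a time: from the tap or a pipe end, through a hose of the player on
that side, and back through a pipe. Such a double step is a pointer that only one of the players has
to know, and it changes sides. So each player can list the pointers of the vertices on one side,
knowing one input only, and the water comes out on Bob's side if and only if the number of pointers
followed from the tap is odd. The water never returns to a vertex, so counting down from the input
length is enough to bound the computation.

The pointers are stored in unary, so that following them takes a fixed number of counters
with values at most the input length. A Turing machine keeps these in binary on logarithmically many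
cells.
-/

/-! ### Computations within an invariant -/

/-- `b` is reached from `a` by steps of `f` that all lead to a configuration satisfying `P`. -/
def ReachesWithin {σ : Type*} (f : σ → Option σ) (P : σ → Prop) : σ → σ → Prop :=
  Relation.ReflTransGen fun a b => b ∈ f a ∧ P b

namespace ReachesWithin

variable {σ : Type*} {f : σ → Option σ} {P : σ → Prop} {a b c : σ}

@[refl]
theorem refl (a : σ) : ReachesWithin f P a a :=
  Relation.ReflTransGen.refl

theorem head (hf : f a = some b) (hb : P b) (h : ReachesWithin f P b c) : ReachesWithin f P a c :=
  Relation.ReflTransGen.head ⟨hf, hb⟩ h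

theorem trans (h : ReachesWithin f P a b) (h' : ReachesWithin f P b c) : ReachesWithin f P a c :=
  Relation.ReflTransGen.trans h h'

theorem reaches (h : ReachesWithin f P a b) : StateTransition.Reaches f a b :=
  Relation.ReflTransGen.mono (fun _ _ hs => hs.1) _ _ h

theorem of_reaches (h : ReachesWithin f P a b) (ha : P a) (hf : f b = none)
    (hc : StateTransition.Reaches f a c) : P c := by
  induction h using Relation.ReflTransGen.head_induction_on with
  | refl =>
    rcases hc.cases_head with rfl | ⟨d, hd, -⟩
    · exact ha
    · simp [hf] at hd
  | head hs _ ih =>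
    rcases hc.cases_head with rfl | ⟨d, hd, hdc⟩
    · exact ha
    · exact ih hs.2 (Option.mem_unique hd hs.1 ▸ hdc)

end ReachesWithin

/-! ### Counter programs -/

/-- An instruction for a program with `k` counters, the states `Q` and a two-way input head, which
moves in the direction `d`. -/
inductive CounterInstr (k : ℕ) (Q : Type) : Type
  /-- Increment counter `i`. -/
  | inc (i : Fin k) (d : HeadMove) (q : Q)
  /-- Decrement counter `i` and go to `q`, or go to `q₀` if the counter is zero. -/
  | dec (i : Fin k) (d : HeadMove) (q q₀ : Q)
  | move (d : HeadMove) (q : Q)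
  | halt (b : Bool)

/-- A counter program: the instruction to execute in each state on each scanned input symbol. -/
abbrev CounterProgram (k : ℕ) (Q : Type) : Type := Q → InputSymbol → CounterInstr k Q

/-- A configuration of a program with `k` counters: the state, the position of the input head and
the counters. -/
structure CounterCfg (k : ℕ) (Q : Type) where
  state : Q
  pos : ℕ
  cnt : Fin k → ℕ

namespace CounterProgram

variable {k : ℕ} {Q : Type}

/-- The instruction that a program executes next, in a given configuration on input `w`. -/
def instr (C : CounterProgram k Q) (w : List Bool) (c : CounterCfg k Q) : CounterInstr k Q :=
  C c.state (OfflineTM.readInput w c.pos)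

/-- One step of a counter program on input `w`; `none` if the program halts. -/
def step (C : CounterProgram k Q) (w : List Bool) (c : CounterCfg k Q) : Option (CounterCfg k Q) :=
  match C.instr w c with
  | .inc i d q =>
    some ⟨q, OfflineTM.moveInput w.length c.pos d, Function.update c.cnt i (c.cnt i + 1)⟩
  | .dec i d q q₀ =>
    some ⟨if c.cnt i = 0 then q₀ else q, OfflineTM.moveInput w.length c.pos d,
      Function.update c.cnt i (c.cnt i - 1)⟩
  | .move d q => some ⟨q, OfflineTM.moveInput w.length c.pos d, c.cnt⟩
  | .halt _ => none

/-- On input `w` the program reaches one configuration from another by steps that all leave the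
counters at most `B`. -/
abbrev ReachesBounded (C : CounterProgram k Q) (w : List Bool) (B : ℕ) :
    CounterCfg k Q → CounterCfg k Q → Prop :=
  ReachesWithin (C.step w) fun c => ∀ i, c.cnt i ≤ B

/-- From the configuration `c` on input `w` the program halts with output `b`, and after each step
its counters are at most `B`. -/
def HaltsWithin (C : CounterProgram k Q) (w : List Bool) (B : ℕ) (b : Bool)
    (c : CounterCfg k Q) : Prop :=
  ∃ c', C.ReachesBounded w B c c' ∧ C.instr w c' = .halt b

theorem HaltsWithin.of_reachesBounded {C : CounterProgram k Q} {w : List Bool} {B : ℕ} {b : Bool}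
    {c d : CounterCfg k Q} (h : C.ReachesBounded w B c d) (hd : C.HaltsWithin w B b d) :
    C.HaltsWithin w B b c :=
  let ⟨c', hr, hb⟩ := hd
  ⟨c', h.trans hr, hb⟩

end CounterProgram

/-! ### Binary counters -/

namespace BinaryCounter

/-- The number with the given binary digits, least significant digit first. -/
def value (l : List Bool) : ℕ := Nat.ofDigits 2 (l.map Bool.toNat)

theorem value_cons (c : Bool) (l : List Bool) : value (c :: l) = c.toNat + 2 * value l := by
  simp [value, Nat.ofDigits_cons]

/-- Flip the digits `b` up to and including the first digit `!b`. For `b = 1` this is the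
successor, for `b = 0` the predecessor, with `none` for underflow. -/
def carry (b : Bool) : List Bool → Option (List Bool)
  | [] => if b then some [true] else none
  | c :: l => if c = b then (carry b l).map ((!b) :: ·) else some (b :: l)

theorem exists_carry_true {l : List Bool} {K : ℕ} (hl : l.length ≤ K) (hv : value l + 1 < 2 ^ K) :
    ∃ l', carry true l = some l' ∧ value l' = value l + 1 ∧ l'.length ≤ K := by
  induction l generalizing K with
  | nil =>
    have hK : K ≠ 0 := by rintro rfl; simp at hv
    exact ⟨[true], rfl, by simp [value], Nat.one_le_iff_ne_zero.2 hK⟩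
  | cons c l ih =>
    cases c
    · exact ⟨true :: l, rfl, by simp [value_cons]; omega, hl⟩
    · obtain ⟨K, rfl⟩ : ∃ K', K = K' + 1 := ⟨K - 1, by simp at hl; omega⟩
      simp only [value_cons, Bool.toNat_true, pow_succ, List.length_cons] at hv hl
      obtain ⟨l', hc, hv', hl'⟩ := ih (K := K) (by omega) (by omega)
      exact ⟨false :: l', by simp [carry, hc], by simp [value_cons, hv']; omega, by simpa using hl'⟩

theorem carry_false_eq_none {l : List Bool} (hv : value l = 0) : carry false l = none := by
  induction l with
  | nil => rfl
  | cons c l ih => cases c <;> simp_all [value_cons, carry]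

theorem exists_carry_false {l : List Bool} (hv : value l ≠ 0) :
    ∃ l', carry false l = some l' ∧ value l' + 1 = value l ∧ l'.length = l.length := by
  induction l with
  | nil => simp [value] at hv
  | cons c l ih =>
    cases c
    · obtain ⟨l', hc, hv', hl'⟩ := ih (by simpa [value_cons] using hv)
      exact ⟨true :: l', by simp [carry, hc], by simp [value_cons]; omega, by simpa using hl'⟩
    · exact ⟨false :: l, rfl, by simp [value_cons, add_comm], rfl⟩

/-- The work tape that holds the given digits from cell `0` on and is blank elsewhere. -/
def tape (l : List Bool) (z : ℤ) : Option Bool :=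
  if z < 0 then none else l[z.toNat]?

@[simp]
theorem tape_nil : tape [] = fun _ => none := by
  funext z; simp [tape]

theorem tape_natCast (l : List Bool) (j : ℕ) : tape l j = l[j]? := by
  simp [tape]

theorem tape_neg_one (l : List Bool) : tape l (-1) = none := by
  simp [tape]

theorem tape_length (l : List Bool) : tape l l.length = none := by
  simp [tape_natCast]

theorem tape_append_length (l m : List Bool) : tape (l ++ m) l.length = m.head? := by
  simp [tape_natCast, List.getElem?_append_right, List.head?_eq_getElem?]

theorem update_tape_append (l m : List Bool) (c : Bool) :
    Function.update (tape (l ++ m)) l.length (some c) = tape (l ++ c :: m.tail) := by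
  funext z
  rcases lt_or_ge z 0 with hz | hz
  · rw [Function.update_of_ne (by omega)]
    simp [tape, hz]
  lift z to ℕ using hz
  rcases lt_trichotomy z l.length with h | rfl | h
  · rw [Function.update_of_ne (by omega)]
    simp [tape_natCast, List.getElem?_append, h]
  · simp [tape_natCast]
  · obtain ⟨j, rfl⟩ := Nat.exists_eq_add_of_lt h
    rw [Function.update_of_ne (by omega)]
    simp only [tape_natCast, List.getElem?_append, add_assoc]
    simp

theorem update_tape_concat_none (l : List Bool) (c : Bool) :
    Function.update (tape (l ++ [c])) l.length none = tape l := by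
  have h := update_tape_append l [] c
  rw [List.tail_nil, List.append_nil] at h
  rw [← h, Function.update_idem, ← tape_length l, Function.update_eq_self]

end BinaryCounter

/-! ### Simulation of counter programs by Turing machines -/

namespace CounterProgram

open BinaryCounter OfflineTM

/-- The tapes `L` hold the binary digits of the counters `a`, at most `K` digits each. -/
def Represents {k : ℕ} (K : ℕ) (L : Fin k → List Bool) (a : Fin k → ℕ) : Prop :=
  ∀ t, value (L t) = a t ∧ (L t).length ≤ K

theorem Represents.update {k K n : ℕ} {L : Fin k → List Bool} {a : Fin k → ℕ} {i : Fin k}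
    {l : List Bool} (h : Represents K L a) (hv : value l = n) (hl : l.length ≤ K) :
    Represents K (Function.update L i l) (Function.update a i n) := by
  intro t
  rcases eq_or_ne t i with rfl | ht
  · simpa using ⟨hv, hl⟩
  · simpa [ht] using h t

/-- The states of the machine that simulates a counter program with `k` counters. -/
inductive SimState (k : ℕ) (Q : Type) : Type
  /-- About to execute the instruction for `q`. -/
  | main (q : Q)
  /-- Propagating a carry on tape `i`; afterwards go to `q`, or to `q₀` after an underflow. -/
  | sweep (b : Bool) (i : Fin k) (q q₀ : Q)
  /-- Returning to cell `0` of tape `i`. -/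
  | back (i : Fin k) (q : Q)
  /-- Erasing tape `i` while returning to cell `0`. -/
  | erase (i : Fin k) (q : Q)
  | halted (b : Bool)
  deriving Fintype

variable {k : ℕ} {Q : Type}

/-- The action on the work tapes that keeps the scanned symbols `σ` and the heads, except that on
tape `i` it writes `a` and moves the head in the direction `d`. -/
def actOn (σ : Fin k → Option Bool) (i : Fin k) (a : Option Bool) (d : HeadMove) :
    Fin k → Option Bool × HeadMove :=
  Function.update (fun t => (σ t, .stay)) i (a, d)

/-- The transition function of the machine that simulates `C`. -/
def simTrans (C : CounterProgram k Q) :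
    SimState k Q → InputSymbol → (Fin k → Option Bool) →
      SimState k Q × HeadMove × (Fin k → Option Bool × HeadMove)
  | .main q, x, σ =>
    match C q x with
    | .inc i d q' => (.sweep true i q' q', d, fun t => (σ t, .stay))
    | .dec i d q' q₀ => (.sweep false i q' q₀, d, fun t => (σ t, .stay))
    | .move d q' => (.main q', d, fun t => (σ t, .stay))
    | .halt b => (.halted b, .stay, fun t => (σ t, .stay))
  | .sweep b i q q₀, _, σ =>
    match σ i with
    | some c =>
      if c = b then (.sweep b i q q₀, .stay, actOn σ i (some !b) .right)
      else (.back i q, .stay, actOn σ i (some b) .left)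
    | none =>
      if b then (.back i q, .stay, actOn σ i (some true) .left)
      else (.erase i q₀, .stay, actOn σ i none .left)
  | .back i q, _, σ =>
    match σ i with
    | some c => (.back i q, .stay, actOn σ i (some c) .left)
    | none => (.main q, .stay, actOn σ i none .right)
  | .erase i q, _, σ =>
    match σ i with
    | some _ => (.erase i q, .stay, actOn σ i none .left)
    | none => (.main q, .stay, actOn σ i none .right)
  | .halted b, _, σ => (.halted b, .stay, fun t => (σ t, .stay))

instance [Finite Q] : Finite (SimState k Q) :=
  have := Fintype.ofFinite Q
  inferInstance

variable [Finite Q]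

/-- The Turing machine that simulates `C` from the state `q`, with the binary digits of each
counter on a work tape of its own. -/
noncomputable abbrev toTM (C : CounterProgram k Q) (q : Q) : OfflineTM where
  numTapes := k
  State := SimState k Q
  decState := Classical.decEq _
  Sym := Option Bool
  blank := none
  start := .main q
  accept := .halted true
  reject := .halted false
  accept_ne_reject := by simp
  trans := C.simTrans

section Simulation

variable {C : CounterProgram k Q} {q₁ : Q}

/-- The configuration of the simulating machine with the digits `L` on the work tapes and the work
heads at `h`. -/
noncomputable def simCfg (C : CounterProgram k Q) (q₁ : Q) (st : SimState k Q) (pos : ℕ)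
    (L : Fin k → List Bool) (h : Fin k → ℤ) : (C.toTM q₁).Cfg where
  state := st
  inputPos := pos
  workPos := h
  work := fun t => tape (L t)

/-- The simulating machine reaches one configuration from another with the work heads always
between the cells `-1` and `K`. -/
abbrev SimReaches (C : CounterProgram k Q) (q₁ : Q) (w : List Bool) (K : ℕ) :
    (C.toTM q₁).Cfg → (C.toTM q₁).Cfg → Prop :=
  ReachesWithin ((C.toTM q₁).step w) fun c => ∀ t, c.workPos t ∈ Set.Icc (-1 : ℤ) K

variable {w : List Bool} {K pos : ℕ} {L : Fin k → List Bool} {i : Fin k} {st st' : SimState k Q}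
  {q q₀ : Q} {c : (C.toTM q₁).Cfg}

theorem step_simCfg {h : Fin k → ℤ} {d : HeadMove} {act : Fin k → Option Bool × HeadMove}
    (hst : ∀ b, st ≠ .halted b)
    (ht : C.simTrans st (readInput w pos) (fun t => tape (L t) (h t)) = (st', d, act)) :
    (C.toTM q₁).step w (C.simCfg q₁ st pos L h) = some
      { state := st'
        inputPos := moveInput w.length pos d
        workPos := fun t => moveWork (h t) (act t).2
        work := fun t => Function.update (tape (L t)) (h t) (act t).1 } := by
  have hst' : ¬(st = .halted true ∨ st = .halted false) := by simp [hst]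
  simp only [OfflineTM.step, simCfg, ht]
  exact if_neg hst'

theorem SimReaches.head_stay {d : HeadMove} (hst : ∀ b, st ≠ .halted b)
    (ht : ∀ σ, C.simTrans st (readInput w pos) σ = (st', d, fun t => (σ t, .stay)))
    (h : C.SimReaches q₁ w K (C.simCfg q₁ st' (moveInput w.length pos d) L 0) c) :
    C.SimReaches q₁ w K (C.simCfg q₁ st pos L 0) c := by
  refine .head (step_simCfg hst (ht _)) (by simp [moveWork]) ?_
  simp only [moveWork, Pi.zero_apply, Function.update_eq_self]
  exact h

theorem SimReaches.head_actOn {l l' : List Bool} {z : ℤ} {a : Option Bool} {d : HeadMove}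
    (hst : ∀ b, st ≠ .halted b)
    (ht : ∀ x σ, σ i = tape l z → C.simTrans st x σ = (st', .stay, actOn σ i a d))
    (hl : Function.update (tape l) z a = tape l') (hz : moveWork z d ∈ Set.Icc (-1 : ℤ) K)
    (h : C.SimReaches q₁ w K
      (C.simCfg q₁ st' pos (Function.update L i l') (Pi.single i (moveWork z d))) c) :
    C.SimReaches q₁ w K (C.simCfg q₁ st pos (Function.update L i l) (Pi.single i z)) c := by
  have hstep : (C.toTM q₁).step w (C.simCfg q₁ st pos (Function.update L i l) (Pi.single i z)) =
      some (C.simCfg q₁ st' pos (Function.update L i l') (Pi.single i (moveWork z d))) := by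
    rw [step_simCfg hst (ht _ _ (by simp)), simCfg]
    congr 2 <;> funext t <;> rcases eq_or_ne t i with rfl | hti <;> simp [actOn, moveWork, *]
  refine .head hstep (fun t => ?_) h
  rcases eq_or_ne t i with rfl | hti <;> simp_all [simCfg]

theorem simReaches_back {l : List Bool} {j : ℕ} (hj : j ≤ l.length) (hK : j ≤ K) :
    C.SimReaches q₁ w K
      (C.simCfg q₁ (.back i q) pos (Function.update L i l) (Pi.single i (j - 1)))
      (C.simCfg q₁ (.main q) pos (Function.update L i l) 0) := by
  induction j with
  | zero =>
    refine .head_actOn (st' := .main q) (a := none) (d := .right) (l' := l) (by simp) ?_ ?_ ?_ ?_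
    · intro x σ hσ
      simp [simTrans, hσ, tape_neg_one]
    · simp [tape_neg_one]
    · simp [moveWork]
    · simpa [moveWork] using .refl _
  | succ j ih =>
    have hc : tape l ((j + 1 : ℕ) - 1) = some l[j] := by simp [tape_natCast]
    refine .head_actOn (st' := .back i q) (a := some l[j]) (d := .left) (l' := l)
      (by simp) ?_ ?_ ?_ ?_
    · intro x σ hσ
      simp only [simTrans, hσ, hc]
    · rw [← hc, Function.update_eq_self]
    · simp only [moveWork, Set.mem_Icc]; omega
    · simpa [moveWork] using ih (by omega) (by omega)

theorem simReaches_erase {l : List Bool} (hl : l.length ≤ K) :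
    C.SimReaches q₁ w K
      (C.simCfg q₁ (.erase i q) pos (Function.update L i l) (Pi.single i (l.length - 1)))
      (C.simCfg q₁ (.main q) pos (Function.update L i []) 0) := by
  induction l using List.reverseRecOn with
  | nil =>
    refine .head_actOn (st' := .main q) (a := none) (d := .right) (l' := []) (by simp) ?_ ?_ ?_ ?_
    · intro x σ hσ
      simp [simTrans, hσ]
    · simp
    · simp [moveWork]
    · simpa [moveWork] using .refl _
  | append_singleton l c ih =>
    simp only [List.length_append, List.length_singleton, Nat.cast_add, Nat.cast_one,
      add_sub_cancel_right] at hl ⊢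
    refine .head_actOn (st' := .erase i q) (a := none) (d := .left) (l' := l) (by simp) ?_ ?_ ?_ ?_
    · intro x σ hσ
      simp [simTrans, hσ, tape_append_length]
    · exact update_tape_concat_none l c
    · simp only [moveWork, Set.mem_Icc]; omega
    · exact ih (by omega)

theorem simReaches_sweep_of_carry_eq_some {e : Bool} {l l' pre : List Bool}
    (hc : carry e l = some l') (hl : (pre ++ l).length ≤ K) :
    C.SimReaches q₁ w K
      (C.simCfg q₁ (.sweep e i q q₀) pos (Function.update L i (pre ++ l))
        (Pi.single i pre.length))
      (C.simCfg q₁ (.main q) pos (Function.update L i (pre ++ l')) 0) := by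
  induction l generalizing pre l' with
  | nil =>
    rw [List.append_nil] at hl ⊢
    obtain ⟨rfl, rfl⟩ : e = true ∧ l' = [true] := by simpa [carry, eq_comm] using hc
    refine .head_actOn (st' := .back i q) (a := some true) (d := .left) (l' := pre ++ [true])
      (by simp) ?_ ?_ ?_ (simReaches_back (by simp) hl)
    · intro x σ hσ
      simp [simTrans, hσ, tape_length]
    · simpa using update_tape_append pre [] true
    · simp only [moveWork, Set.mem_Icc]; omega
  | cons c l ih =>
    rcases eq_or_ne c e with rfl | hce
    · obtain ⟨m, hm, rfl⟩ : ∃ m, carry c l = some m ∧ (!c) :: m = l' := by simpa [carry] using hc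
      refine .head_actOn (st' := .sweep c i q q₀) (a := some !c) (d := .right)
        (l' := pre ++ (!c) :: l) (by simp) ?_ (update_tape_append pre (c :: l) !c) ?_ ?_
      · intro x σ hσ
        simp [simTrans, hσ, tape_append_length]
      · simp only [moveWork, Set.mem_Icc, List.length_append, List.length_cons] at hl ⊢; omega
      · simpa [moveWork] using ih (pre := pre ++ [!c]) hm (by simpa using hl)
    · obtain rfl : e :: l = l' := by simpa [carry, hce] using hc
      refine .head_actOn (st' := .back i q) (a := some e) (d := .left) (l' := pre ++ e :: l)
        (by simp) ?_ (update_tape_append pre (c :: l) e) ?_ (simReaches_back (by simp) ?_)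
      · intro x σ hσ
        simp [simTrans, hσ, tape_append_length, hce]
      all_goals
        simp only [moveWork, Set.mem_Icc, List.length_append, List.length_cons] at hl ⊢; omega

theorem simReaches_sweep_of_carry_eq_none {l pre : List Bool}
    (hc : carry false l = none) (hl : (pre ++ l).length ≤ K) :
    C.SimReaches q₁ w K
      (C.simCfg q₁ (.sweep false i q q₀) pos (Function.update L i (pre ++ l))
        (Pi.single i pre.length))
      (C.simCfg q₁ (.main q₀) pos (Function.update L i []) 0) := by
  induction l generalizing pre with
  | nil =>
    rw [List.append_nil] at hl ⊢
    refine .head_actOn (st' := .erase i q₀) (a := none) (d := .left) (l' := pre) (by simp) ?_ ?_ ?_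
      (simReaches_erase hl)
    · intro x σ hσ
      simp [simTrans, hσ, tape_length]
    · rw [← tape_length pre, Function.update_eq_self]
    · simp only [moveWork, Set.mem_Icc]; omega
  | cons c l ih =>
    obtain ⟨rfl, hc'⟩ : c = false ∧ carry false l = none := by
      cases c <;> simp_all [carry]
    refine .head_actOn (st' := .sweep false i q q₀) (a := some true) (d := .right)
      (l' := pre ++ true :: l) (by simp) ?_ (update_tape_append pre (false :: l) true) ?_ ?_
    · intro x σ hσ
      simp [simTrans, hσ, tape_append_length]
    · simp only [moveWork, Set.mem_Icc, List.length_append, List.length_cons] at hl ⊢; omega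
    · simpa [moveWork] using ih (pre := pre ++ [true]) hc' (by simpa using hl)

theorem simReaches_inc {a : Fin k → ℕ} (ha : Represents K L a) (hi : a i + 1 < 2 ^ K) :
    ∃ L', Represents K L' (Function.update a i (a i + 1)) ∧
      C.SimReaches q₁ w K (C.simCfg q₁ (.sweep true i q q₀) pos L 0)
        (C.simCfg q₁ (.main q) pos L' 0) := by
  obtain ⟨hv, hl⟩ := ha i
  obtain ⟨l, hc, hv', hl'⟩ := exists_carry_true hl (by rwa [hv])
  refine ⟨_, ha.update (i := i) (hv'.trans (by rw [hv])) hl', ?_⟩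
  simpa using simReaches_sweep_of_carry_eq_some (L := L) (i := i) (pre := []) hc hl

theorem simReaches_dec {a : Fin k → ℕ} (ha : Represents K L a) :
    ∃ L', Represents K L' (Function.update a i (a i - 1)) ∧
      C.SimReaches q₁ w K (C.simCfg q₁ (.sweep false i q q₀) pos L 0)
        (C.simCfg q₁ (.main (if a i = 0 then q₀ else q)) pos L' 0) := by
  obtain ⟨hv, hl⟩ := ha i
  split_ifs with hi
  · refine ⟨_, ha.update (i := i) (l := []) (by simp [value, hi]) (Nat.zero_le K), ?_⟩
    simpa using simReaches_sweep_of_carry_eq_none (L := L) (i := i) (pre := [])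
      (carry_false_eq_none (hv.trans hi)) hl
  · obtain ⟨l, hc, hv', hl'⟩ := exists_carry_false (hv.trans_ne hi)
    refine ⟨_, ha.update (i := i) (l := l) (by omega) (hl'.trans_le hl), ?_⟩
    simpa using simReaches_sweep_of_carry_eq_some (L := L) (i := i) (pre := []) hc hl

theorem exists_simReaches_of_step {e e' : CounterCfg k Q} (hs : C.step w e = some e')
    (hL : Represents K L e.cnt) (hK : ∀ i, e'.cnt i < 2 ^ K) :
    ∃ L', Represents K L' e'.cnt ∧ C.SimReaches q₁ w K
      (C.simCfg q₁ (.main e.state) e.pos L 0) (C.simCfg q₁ (.main e'.state) e'.pos L' 0) := by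
  cases hi : C e.state (readInput w e.pos) with
  | inc i d q =>
    rw [step, instr, hi] at hs
    cases hs
    obtain ⟨L', hL', h⟩ := simReaches_inc (C := C) (q₁ := q₁) (q₀ := q) hL (by simpa using hK i)
    exact ⟨L', hL', .head_stay (by simp) (fun σ => by simp only [simTrans, hi]) h⟩
  | dec i d q q₀ =>
    rw [step, instr, hi] at hs
    cases hs
    obtain ⟨L', hL', h⟩ := simReaches_dec (C := C) (q₁ := q₁) hL
    exact ⟨L', hL', .head_stay (by simp) (fun σ => by simp only [simTrans, hi]) h⟩
  | move d q =>
    rw [step, instr, hi] at hs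
    cases hs
    exact ⟨L, hL, .head_stay (by simp) (fun σ => by simp only [simTrans, hi]) (.refl _)⟩
  | halt b => simp [step, instr, hi] at hs

theorem HaltsWithin.exists_simReaches {B : ℕ} {b : Bool} {e : CounterCfg k Q}
    (h : C.HaltsWithin w B b e) (hB : B < 2 ^ K) (hL : Represents K L e.cnt) :
    ∃ pos L', C.SimReaches q₁ w K (C.simCfg q₁ (.main e.state) e.pos L 0)
      (C.simCfg q₁ (.halted b) pos L' 0) := by
  obtain ⟨e', hr, hb : C e'.state (readInput w e'.pos) = .halt b⟩ := h
  induction hr using Relation.ReflTransGen.head_induction_on generalizing L with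
  | refl =>
    exact ⟨_, L, .head_stay (d := .stay) (by simp) (fun σ => by simp only [simTrans, hb])
      (.refl _)⟩
  | head hs _ ih =>
    obtain ⟨L', hL', hr'⟩ := exists_simReaches_of_step hs.1 hL fun i => (hs.2 i).trans_lt hB
    obtain ⟨pos, L'', hr''⟩ := ih hL'
    exact ⟨pos, L'', hr'.trans hr''⟩

end Simulation

theorem encard_visited_toTM_le {C : CounterProgram k Q} {q : Q} {w : List Bool} {K : ℕ}
    {c : (C.toTM q).Cfg} (h : C.SimReaches q w K (C.toTM q).init c)
    (hc : (C.toTM q).step w c = none) :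
    ((C.toTM q).visited w).encard ≤ (k * (K + 2) : ℕ) := by
  have hsub : (C.toTM q).visited w ⊆
      ↑(Finset.univ ×ˢ Finset.Icc (-1 : ℤ) K : Finset (Fin k × ℤ)) := by
    rintro ⟨t, z⟩ ⟨c', hc', rfl : c'.workPos t = z⟩
    simpa using h.of_reaches (by simp [init]) hc hc' t
  refine (Set.encard_le_encard hsub).trans_eq ?_
  rw [Set.encard_coe_eq_coe_finsetCard, Finset.card_product, Finset.card_univ, Fintype.card_fin,
    Int.card_Icc]
  congr 2

theorem logSpaceComputable (C : CounterProgram k Q) (q : Q) {g : ∀ m : ℕ, Bits m → Bits m → Bool}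
    (h : ∀ m (x y : Bits m),
      C.HaltsWithin (List.ofFn x ++ List.ofFn y) (2 * m) (g m x y) ⟨q, 1, 0⟩) :
    LogSpaceComputable g := by
  refine ⟨C.toTM q, 4 * k, fun m x y => ?_⟩
  obtain ⟨pos, L, hr⟩ := (h m x y).exists_simReaches (q₁ := q) (K := Nat.log 2 (2 * m) + 1)
    (L := fun _ => []) (Nat.lt_pow_succ_log_self one_lt_two _) (fun t => by simp [value])
  have hinit : C.simCfg q (.main q) 1 (fun _ => []) 0 = (C.toTM q).init := by
    simp [simCfg, init, Pi.zero_def]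
  rw [hinit] at hr
  refine ⟨⟨_, hr.reaches, by cases g m x y <;> rfl⟩, fun hm => ?_⟩
  have hlog : 1 ≤ Nat.log 2 (2 * m) := Nat.log_pos one_lt_two hm
  refine (encard_visited_toTM_le hr (by cases g m x y <;> simp [OfflineTM.step, simCfg])).trans ?_
  exact_mod_cast (by nlinarith :
    k * (Nat.log 2 (2 * m) + 1 + 2) ≤ 4 * k * Nat.log 2 (2 * m))

end CounterProgram

/-! ### Pointer chasing -/

namespace PointerChasing

open OfflineTM

/-- Follow the pointers `next` from `i` to a node without pointer, which is one with `next i = 0`,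
and tell whether `t` was flipped an odd number of times; `false` if this takes `F` steps or more. -/
def chase (next : ℕ → ℕ) : (F : ℕ) → (t : Bool) → (i : ℕ) → Bool
  | 0, _, _ => false
  | F + 1, t, i => if next i = 0 then t else chase next F (!t) (next i)

theorem chase_eq_of_forall_lt {next : ℕ → ℕ} {F r : ℕ} (t : Bool) {i : ℕ → ℕ} (hF : r < F)
    (h : ∀ k < r, next (i k) = i (k + 1) ∧ i (k + 1) ≠ 0) (hr : next (i r) = 0) :
    chase next F t (i 0) = (t ^^ r.bodd) := by
  induction r generalizing F t i with
  | zero =>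
    obtain ⟨F, rfl⟩ := Nat.exists_eq_add_of_lt hF
    simp [chase, hr]
  | succ r ih =>
    obtain ⟨F, rfl⟩ := Nat.exists_eq_add_of_lt (Nat.zero_lt_of_lt hF)
    obtain ⟨hnext, hne⟩ := h 0 r.succ_pos
    rw [chase, hnext, if_neg hne, ih (i := fun k => i (k + 1)) (!t) (by omega)
      (fun k hk => h (k + 1) (by omega)) hr, Nat.bodd_succ]
    simp

/-- Remove the first block from a word in which each number `d` is stored as a block `1^d 0`. -/
def dropBlock (w : List Bool) : List Bool := (w.dropWhile id).tail

/-- The number stored in block `i` of a word. -/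
def pointer (w : List Bool) (i : ℕ) : ℕ := ((dropBlock^[i] w).takeWhile id).length

/-- The position at which the suffix `v` of the input `w` begins; it is the right end marker for
`v = []`. -/
def suffixPos (w v : List Bool) : ℕ := w.length + 1 - v.length

section SuffixPos

variable {w v : List Bool}

theorem suffixPos_self : suffixPos w w = 1 := by
  simp [suffixPos]

theorem readInput_suffixPos_nil : readInput w (suffixPos w []) = .rightEnd := by
  simp [suffixPos, readInput]

theorem readInput_suffixPos_cons {b : Bool} (h : b :: v <:+ w) :
    readInput w (suffixPos w (b :: v)) = .bit b := by
  obtain ⟨u, rfl⟩ := h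
  have hpos : suffixPos (u ++ b :: v) (b :: v) = u.length + 1 := by simp [suffixPos]; omega
  simp [hpos, readInput]

theorem moveInput_right_suffixPos (h : v <:+ w) :
    moveInput w.length (suffixPos w v) .right = suffixPos w v.tail := by
  have := h.length_le
  rw [moveInput, suffixPos, suffixPos, List.length_tail]
  omega

theorem isSuffix_dropBlock (h : v <:+ w) : dropBlock v <:+ w :=
  (List.tail_suffix _).trans ((List.dropWhile_suffix _).trans h)

theorem isSuffix_dropBlock_iterate (i : ℕ) : dropBlock^[i] w <:+ w := by
  induction i with
  | zero => exact List.suffix_rfl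
  | succ i ih => exact Function.iterate_succ_apply' dropBlock i w ▸ isSuffix_dropBlock ih

end SuffixPos

/-- The states of the program for pointer chasing, in which `t` counts the followed pointers
modulo two. -/
inductive ChaserState : Type
  /-- Storing the length of the input in counter `0`, which holds the remaining fuel. -/
  | load
  /-- Returning to the left end marker, with the next node in counter `1`. -/
  | rewind (t : Bool)
  /-- In front of a block, with the number of blocks to skip in counter `1`. -/
  | skip (t : Bool)
  /-- Moving to the end of a block. -/
  | seek (t : Bool)
  /-- At the first symbol of the block of the current node. -/
  | first (t : Bool)
  /-- Copying the pointer of the current node to counter `1`. -/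
  | read (t : Bool)
  /-- Out of fuel. -/
  | fail
  deriving Fintype

/-- The program for pointer chasing. -/
def chaser : CounterProgram 2 ChaserState
  | .load, .bit _ => .inc 0 .right .load
  | .load, _ => .move .stay (.rewind false)
  | .rewind t, .leftEnd => .dec 0 .stay (.skip t) .fail
  | .rewind t, _ => .move .left (.rewind t)
  | .skip t, _ => .dec 1 .right (.seek t) (.first t)
  | .seek t, .bit true => .move .right (.seek t)
  | .seek t, _ => .move .stay (.skip t)
  | .first t, .bit true => .move .stay (.read t)
  | .first t, _ => .halt t
  | .read t, .bit true => .inc 1 .right (.read t)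
  | .read t, _ => .move .stay (.rewind !t)
  | .fail, _ => .halt false

section Chaser

variable {w v : List Bool} {B F a p : ℕ} {t : Bool}

/-- The configuration with fuel `F` and `a` in counter `1`. -/
def chaserCfg (q : ChaserState) (p F a : ℕ) : CounterCfg 2 ChaserState := ⟨q, p, ![F, a]⟩

theorem update_zero_fin_two (x : ℕ) : Function.update ![F, a] 0 x = ![x, a] := by
  ext i; fin_cases i <;> rfl

theorem update_one_fin_two (x : ℕ) : Function.update ![F, a] 1 x = ![F, x] := by
  ext i; fin_cases i <;> rfl

attribute [local simp] CounterProgram.step CounterProgram.instr chaserCfg chaser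
  update_zero_fin_two update_one_fin_two

theorem reachesBounded_head {q q' : ChaserState} {p' F' a' : ℕ} {c : CounterCfg 2 ChaserState}
    (hs : chaser.step w (chaserCfg q p F a) = some (chaserCfg q' p' F' a')) (hF : F' ≤ B)
    (ha : a' ≤ B) (h : chaser.ReachesBounded w B (chaserCfg q' p' F' a') c) :
    chaser.ReachesBounded w B (chaserCfg q p F a) c :=
  .head hs (Fin.forall_fin_two.2 ⟨hF, ha⟩) h

theorem reachesBounded_load (hv : v <:+ w) (hB : F + v.length ≤ B) :
    chaser.ReachesBounded w B (chaserCfg .load (suffixPos w v) F 0)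
      (chaserCfg (.rewind false) (suffixPos w []) (F + v.length) 0) := by
  induction v generalizing F with
  | nil =>
    refine reachesBounded_head ?_ hB (Nat.zero_le B) (.refl _)
    simp [readInput_suffixPos_nil, moveInput]
  | cons b v ih =>
    rw [List.length_cons] at hB ⊢
    have hs : chaser.step w (chaserCfg .load (suffixPos w (b :: v)) F 0) =
        some (chaserCfg .load (suffixPos w v) (F + 1) 0) := by
      simp [readInput_suffixPos_cons hv, moveInput_right_suffixPos hv]
    refine reachesBounded_head hs (by omega) (Nat.zero_le B) ?_
    rw [← add_assoc, add_right_comm] at hB ⊢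
    exact ih ((List.suffix_cons b v).trans hv) hB

theorem reachesBounded_rewind (hF : F ≤ B) (ha : a ≤ B) :
    chaser.ReachesBounded w B (chaserCfg (.rewind t) p F a) (chaserCfg (.rewind t) 0 F a) := by
  induction p with
  | zero => exact .refl _
  | succ p ih =>
    refine reachesBounded_head ?_ hF ha ih
    rcases h : w[p]? with _ | b <;> simp [readInput, moveInput, h]

theorem reachesBounded_seek (hv : v <:+ w) (hF : F ≤ B) (ha : a ≤ B) :
    chaser.ReachesBounded w B (chaserCfg (.seek t) (suffixPos w v) F a)
      (chaserCfg (.skip t) (suffixPos w (v.dropWhile id)) F a) := by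
  induction v with
  | nil =>
    refine reachesBounded_head ?_ hF ha (.refl _)
    simp [readInput_suffixPos_nil, moveInput]
  | cons b v ih =>
    have hpos : readInput w (suffixPos w (b :: v)) = .bit b := readInput_suffixPos_cons hv
    cases b
    · refine reachesBounded_head ?_ hF ha (.refl _)
      simp [hpos, moveInput]
    · refine reachesBounded_head ?_ hF ha (ih ((List.suffix_cons true v).trans hv))
      simp [hpos, moveInput_right_suffixPos hv]

theorem reachesBounded_skip (hv : v <:+ w) (hp : moveInput w.length p .right = suffixPos w v)
    (hF : F ≤ B) (ha : a ≤ B) :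
    chaser.ReachesBounded w B (chaserCfg (.skip t) p F a)
      (chaserCfg (.first t) (suffixPos w (dropBlock^[a] v)) F 0) := by
  induction a generalizing p v with
  | zero =>
    refine reachesBounded_head ?_ hF ha (.refl _)
    simp [hp]
  | succ a ih =>
    have hs : chaser.step w (chaserCfg (.skip t) p F (a + 1)) =
        some (chaserCfg (.seek t) (suffixPos w v) F a) := by
      simp [hp]
    refine reachesBounded_head hs hF (by omega) ?_
    refine (reachesBounded_seek hv hF (by omega)).trans ?_
    exact ih (isSuffix_dropBlock hv)
      (moveInput_right_suffixPos ((List.dropWhile_suffix _).trans hv)) (by omega)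

theorem reachesBounded_read (hv : v <:+ w) (hF : F ≤ B) (ha : a + v.length ≤ B) :
    chaser.ReachesBounded w B (chaserCfg (.read t) (suffixPos w v) F a)
      (chaserCfg (.rewind !t) (suffixPos w (v.dropWhile id)) F
        (a + (v.takeWhile id).length)) := by
  induction v generalizing a with
  | nil =>
    refine reachesBounded_head ?_ hF ha (.refl _)
    simp [readInput_suffixPos_nil, moveInput]
  | cons b v ih =>
    rw [List.length_cons] at ha
    have hpos : readInput w (suffixPos w (b :: v)) = .bit b := readInput_suffixPos_cons hv
    cases b
    · refine reachesBounded_head ?_ hF (by simp; omega) (.refl _)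
      simp [hpos, moveInput]
    · have hs : chaser.step w (chaserCfg (.read t) (suffixPos w (true :: v)) F a) =
          some (chaserCfg (.read t) (suffixPos w v) F (a + 1)) := by
        simp [hpos, moveInput_right_suffixPos hv]
      refine reachesBounded_head hs hF (by omega) ?_
      simpa [add_right_comm, add_assoc] using
        ih ((List.suffix_cons true v).trans hv) (a := a + 1) (by omega)

theorem haltsWithin_first_of_takeWhile_length_eq_zero (hv : v <:+ w)
    (h : (v.takeWhile id).length = 0) :
    chaser.HaltsWithin w B t (chaserCfg (.first t) (suffixPos w v) F a) := by
  refine ⟨_, .refl _, ?_⟩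
  rcases v with _ | ⟨_ | _, v⟩
  · simp [readInput_suffixPos_nil]
  · simp [readInput_suffixPos_cons hv]
  · simp at h

theorem reachesBounded_first_of_takeWhile_length_ne_zero (hv : v <:+ w)
    (h : (v.takeWhile id).length ≠ 0) (hw : w.length ≤ B) (hF : F ≤ B) :
    chaser.ReachesBounded w B (chaserCfg (.first t) (suffixPos w v) F 0)
      (chaserCfg (.rewind !t) (suffixPos w (v.dropWhile id)) F (v.takeWhile id).length) := by
  rcases v with _ | ⟨_ | _, v⟩
  · simp at h
  · simp at h
  · have hs : chaser.step w (chaserCfg (.first t) (suffixPos w (true :: v)) F 0) =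
        some (chaserCfg (.read t) (suffixPos w (true :: v)) F 0) := by
      simp [readInput_suffixPos_cons hv, moveInput]
    refine reachesBounded_head hs hF (Nat.zero_le B) ?_
    have hB : 0 + (true :: v).length ≤ B := by simpa using hv.length_le.trans hw
    simpa only [zero_add] using reachesBounded_read hv hF hB

theorem haltsWithin_rewind (hw : w.length ≤ B) (hF : F ≤ B) (ha : a ≤ B) :
    chaser.HaltsWithin w B (chase (pointer w) F t a) (chaserCfg (.rewind t) p F a) := by
  induction F generalizing t a p with
  | zero =>
    have hs : chaser.step w (chaserCfg (.rewind t) 0 0 a) = some (chaserCfg .fail 0 0 a) := by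
      simp [readInput, moveInput]
    exact .of_reachesBounded ((reachesBounded_rewind hF ha).trans
      (reachesBounded_head hs hF ha (.refl _))) ⟨_, .refl _, rfl⟩
  | succ F ih =>
    have hF' : F ≤ B := by omega
    have hs : chaser.step w (chaserCfg (.rewind t) 0 (F + 1) a) =
        some (chaserCfg (.skip t) 0 F a) := by
      simp [readInput, moveInput]
    have hskip := reachesBounded_skip (t := t) (p := 0) (List.suffix_refl w)
      (by simp [moveInput, suffixPos_self]) hF' ha
    refine .of_reachesBounded
      ((reachesBounded_rewind hF ha).trans (reachesBounded_head hs hF' ha hskip)) ?_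
    have hv : dropBlock^[a] w <:+ w := isSuffix_dropBlock_iterate a
    rw [chase]
    split_ifs with h
    · exact haltsWithin_first_of_takeWhile_length_eq_zero hv h
    · have hle : pointer w a ≤ B :=
        (List.takeWhile_prefix id).length_le.trans (hv.length_le.trans hw)
      exact .of_reachesBounded (reachesBounded_first_of_takeWhile_length_ne_zero hv h hw hF')
        (ih hF' hle)

end Chaser

/-- The word `xy` encodes pointers; output the parity of the number of pointers that are followed
from node `0` until a node without pointer is reached. -/
def pointerChase (m : ℕ) (x y : Bits m) : Bool :=
  chase (pointer (List.ofFn x ++ List.ofFn y)) (List.ofFn x ++ List.ofFn y).length false 0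

theorem logSpaceComputable_pointerChase : LogSpaceComputable pointerChase := by
  refine chaser.logSpaceComputable .load fun m x y => ?_
  unfold pointerChase
  set w := List.ofFn x ++ List.ofFn y
  have hlen : w.length = 2 * m := by simp [w, two_mul]
  have hload := reachesBounded_load (F := 0) (List.suffix_refl w) (by rw [zero_add, hlen])
  have hhalts := haltsWithin_rewind (t := false) (p := suffixPos w []) hlen.le hlen.le
    (Nat.zero_le _)
  rw [zero_add, suffixPos_self] at hload
  have hinit : chaserCfg .load 1 0 0 = ⟨.load, 1, 0⟩ := by
    simp [chaserCfg, ← Matrix.zero_empty, ← Matrix.cons_zero_zero]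
  exact hinit ▸ .of_reachesBounded hload hhalts

section Encoding

/-- The word that stores the number `d`. -/
def block (d : ℕ) : List Bool := List.replicate d true ++ [false]

theorem dropBlock_block_append (d : ℕ) (v : List Bool) : dropBlock (block d ++ v) = v := by
  simp [dropBlock, block, List.dropWhile_append_of_pos]

theorem pointer_flatMap_block (D : List ℕ) (i : ℕ) : pointer (D.flatMap block) i = D.getD i 0 := by
  induction D generalizing i with
  | nil => simp [pointer, Function.iterate_fixed (show dropBlock [] = [] from rfl)]
  | cons d D ih =>
    cases i with
    | zero => simp [pointer, block, List.takeWhile_append_of_pos]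
    | succ i =>
      rw [pointer, Function.iterate_succ_apply, List.flatMap_cons, dropBlock_block_append,
        ← pointer, ih, List.getD_cons_succ]

theorem length_flatMap_block (D : List ℕ) : (D.flatMap block).length = D.sum + D.length := by
  induction D with
  | nil => rfl
  | cons d D ih => simp [ih, block]; omega

/-- The word of length `m` that stores the numbers in `D` and one more number as padding. -/
def paddedBlocks (m : ℕ) (D : List ℕ) : List Bool :=
  (D ++ [m - 1 - (D.sum + D.length)]).flatMap block

theorem length_paddedBlocks {m : ℕ} {D : List ℕ} (h : D.sum + D.length < m) :
    (paddedBlocks m D).length = m := by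
  rw [paddedBlocks, length_flatMap_block, List.sum_append, List.length_append,
    List.sum_singleton, List.length_singleton]
  omega

theorem exists_ofFn_eq {m : ℕ} {w : List Bool} (h : w.length = m) :
    ∃ x : Bits m, List.ofFn x = w := by
  subst h
  exact ⟨w.get, List.ofFn_get w⟩

variable {m i : ℕ} {D E : List ℕ}

theorem pointer_paddedBlocks_append_left (hi : i < D.length) :
    pointer (paddedBlocks m D ++ paddedBlocks m E) i = D[i] := by
  rw [paddedBlocks, paddedBlocks, ← List.flatMap_append, pointer_flatMap_block, List.append_assoc,
    List.getD_append _ _ _ _ hi, List.getD_eq_getElem _ _ hi]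

theorem pointer_paddedBlocks_append_right (hi : i < E.length) :
    pointer (paddedBlocks m D ++ paddedBlocks m E) (D.length + 1 + i) = E[i] := by
  rw [paddedBlocks, paddedBlocks, ← List.flatMap_append, pointer_flatMap_block,
    List.getD_append_right _ _ _ _ (by simp), List.length_append, List.length_singleton,
    Nat.add_sub_cancel_left, List.getD_append _ _ _ _ hi, List.getD_eq_getElem _ _ hi]

end Encoding

end PointerChasing

/-! ### Alternating paths -/

namespace AlternatingPath

variable {V : Type*} {G H : SimpleGraph V} {u v : V} {p : G.Walk u v}

theorem adj_getVert_succ_iff_odd (hGH : G.IsAlternating H) (hu : ∀ w, ¬H.Adj u w) (hp : p.IsPath)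
    {j : ℕ} (hj : j < p.length) : H.Adj (p.getVert j) (p.getVert (j + 1)) ↔ Odd j := by
  induction j with
  | zero => simp [hu]
  | succ j ih =>
    have hne : p.getVert j ≠ p.getVert (j + 2) := fun h => by
      have := hp.getVert_injOn (by simp; omega) (by simp; omega) h
      omega
    rw [← not_iff_not, ← hGH hne (p.adj_getVert_succ (by omega)).symm (p.adj_getVert_succ hj),
      H.adj_comm, ih (by omega), Nat.not_odd_iff_even, Nat.even_add_one, Nat.not_even_iff_odd]

theorem eq_penultimate_of_adj_of_mem_support (hGH : G.IsAlternating H) (hu : ∀ w, ¬H.Adj u w)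
    (hp : p.IsPath) {w : V} (hw : G.Adj v w) (hmem : w ∈ p.support) : w = p.penultimate := by
  have hne {i j : ℕ} (hi : i ≤ p.length) (hj : j ≤ p.length) (hij : i ≠ j) :
      p.getVert i ≠ p.getVert j := fun h => hij (hp.getVert_injOn hi hj h)
  obtain ⟨i, rfl, hi⟩ := SimpleGraph.Walk.mem_support_iff_exists_getVert.1 hmem
  have hlast : i ≠ p.length := by
    rintro rfl
    simp at hw
  by_contra hpen
  have hi' : i + 1 < p.length := by
    contrapose! hpen
    rw [SimpleGraph.Walk.penultimate]
    congr 1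
    omega
  have hnext := p.adj_getVert_succ (i := i) (by omega)
  have hne_last {j : ℕ} (hj : j < p.length) : p.getVert j ≠ v :=
    fun h => hne hj.le le_rfl hj.ne (h.trans p.getVert_length.symm)
  have hnext_last := hGH (hne_last hi') hnext hw.symm
  cases i with
  | zero =>
    rw [p.getVert_zero] at hnext_last
    exact hu _ (hnext_last.2 (hu v))
  | succ i =>
    have hprev := (p.adj_getVert_succ (i := i) (by omega)).symm
    have hprev_last := hGH (hne_last (by omega)) hprev hw.symm
    have hprev_next := hGH (hne (by omega) (by omega) (by omega)) hprev hnext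
    tauto

theorem even_length_and_forall_adj_of_forall_mem_support (hGH : G.IsAlternating H) (hle : H ≤ G)
    (hu : ∀ w, ¬H.Adj u w) (hV : ∀ w ≠ u, ∃ z, H.Adj w z) (hp : p.IsPath)
    (hv : ∀ w, G.Adj v w → w ∈ p.support) :
    Even p.length ∧ ∀ w, G.Adj v w → H.Adj v w := by
  have hpen (w : V) (hw : G.Adj v w) : w = p.penultimate :=
    eq_penultimate_of_adj_of_mem_support hGH hu hp hw (hv w hw)
  rcases eq_or_ne v u with rfl | hvu
  · have hnil : p = .nil := (SimpleGraph.Walk.isPath_iff_nil.1 hp).eq_nil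
    subst hnil
    exact ⟨by simp, fun w hw => absurd (hpen w hw) hw.ne'⟩
  · obtain ⟨z, hz⟩ := hV v hvu
    obtain rfl := hpen z (hle hz)
    obtain ⟨n, hn⟩ : ∃ n, p.length = n + 1 :=
      Nat.exists_eq_succ_of_ne_zero fun h => hvu (p.eq_of_length_eq_zero h).symm
    have hodd := adj_getVert_succ_iff_odd hGH hu hp (j := n) (by omega)
    rw [← hn, p.getVert_length, show n = p.length - 1 by omega] at hodd
    refine ⟨?_, fun w hw => hpen w hw ▸ hz⟩
    rw [hn]
    simpa [hn] using (hodd.1 hz.symm).add_one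

end AlternatingPath

/-! ### Following the water -/

namespace GardenHoseGame

variable {n s : ℕ} (G : GardenHoseGame n s) {x y : Bits n}

section Graph

variable {a b : Option (Fin s)} {i j : Fin s} {u v w : Option (Fin s) ⊕ Fin s}

@[simp]
theorem pipes_adj_inl_inr : (pipes s).Adj (.inl a) (.inr j) ↔ a = some j := by
  simp [pipes]

@[simp]
theorem pipes_adj_inr_inl : (pipes s).Adj (.inr j) (.inl a) ↔ a = some j := by
  rw [SimpleGraph.adj_comm, pipes_adj_inl_inr]

@[simp]
theorem not_pipes_adj_inl_inl : ¬(pipes s).Adj (.inl a) (.inl b) := by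
  simp [pipes]

@[simp]
theorem not_pipes_adj_inr_inr : ¬(pipes s).Adj (.inr i) (.inr j) := by
  simp [pipes]

@[simp]
theorem graph_adj_inl_inl : (G.graph x y).Adj (.inl a) (.inl b) ↔ (G.alice x).Adj a b := by
  simp [graph]

@[simp]
theorem graph_adj_inr_inr : (G.graph x y).Adj (.inr i) (.inr j) ↔ (G.bob y).Adj i j := by
  simp [graph]

@[simp]
theorem graph_adj_inl_inr : (G.graph x y).Adj (.inl a) (.inr j) ↔ a = some j := by
  simp [graph]

@[simp]
theorem graph_adj_inr_inl : (G.graph x y).Adj (.inr j) (.inl a) ↔ a = some j := by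
  simp [graph]

theorem pipes_le_graph : pipes s ≤ G.graph x y :=
  le_sup_left.trans le_sup_left

theorem not_pipes_adj_tap : ¬(pipes s).Adj (tap s) v := by
  cases v <;> simp

theorem exists_pipes_adj (hv : v ≠ tap s) : ∃ w, (pipes s).Adj v w := by
  rcases v with (_ | i) | j
  · exact absurd rfl hv
  · exact ⟨.inr i, by simp⟩
  · exact ⟨.inl (some j), by simp⟩

theorem isAlternating_graph_pipes : (G.graph x y).IsAlternating (pipes s) := by
  rintro (a | i) (b | j) (c | k) hne hv hw <;>
    grind [graph_adj_inl_inl, graph_adj_inl_inr, graph_adj_inr_inl, graph_adj_inr_inr,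
      pipes_adj_inl_inr, pipes_adj_inr_inl, not_pipes_adj_inl_inl, not_pipes_adj_inr_inr,
      alice_unique, bob_unique]

theorem isRight_of_pipes_adj (h : (pipes s).Adj u v) : v.isRight = !u.isRight := by
  cases u <;> cases v <;> simp_all

variable {G} in
theorem isRight_of_graph_adj_of_not_pipes_adj (h : (G.graph x y).Adj u v)
    (hpipe : ¬(pipes s).Adj u v) : v.isRight = u.isRight := by
  cases u <;> cases v <;> simp_all

end Graph

/-- The number of a vertex in `pointerChase`: the tap comes first, then Alice's pipe ends and,
after the padding of Alice's word, Bob's pipe ends. -/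
def vertexIndex : Option (Fin s) ⊕ Fin s → ℕ
  | .inl none => 0
  | .inl (some i) => i + 1
  | .inr j => s + 2 + j

theorem vertexIndex_ne_zero {v : Option (Fin s) ⊕ Fin s} (hv : v ≠ tap s) : vertexIndex v ≠ 0 := by
  rcases v with (_ | i) | j <;> simp_all [vertexIndex]

open Classical in
/-- The number of the vertex that the water reaches from Alice's vertex `a` through one of her
hoses and the pipe behind it, and `0` if there is no such vertex. -/
noncomputable def aliceNext (x : Bits n) (a : Option (Fin s)) : ℕ :=
  if h : ∃ j, (G.alice x).Adj a (some j) then vertexIndex (.inr h.choose) else 0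

open Classical in
/-- The number of the vertex that the water reaches from Bob's vertex `i` through one of his
hoses and the pipe behind it, and `0` if there is no such vertex. -/
noncomputable def bobNext (y : Bits n) (i : Fin s) : ℕ :=
  if h : ∃ j, (G.bob y).Adj i j then vertexIndex (.inl (some h.choose)) else 0

/-- The number of the vertex two edges further along the water's way, where the first edge belongs
to a player and the second one is a pipe, and `0` if there is no such vertex. -/
noncomputable def next (x y : Bits n) : Option (Fin s) ⊕ Fin s → ℕ :=
  Sum.elim (G.aliceNext x) (G.bobNext y)

variable {G} {u v w : Option (Fin s) ⊕ Fin s}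

theorem next_eq_vertexIndex (huv : (G.graph x y).Adj u v) (hpipe : ¬(pipes s).Adj u v)
    (hvw : (pipes s).Adj v w) : G.next x y u = vertexIndex w := by
  rcases u with a | i <;> rcases v with b | j <;> rcases w with c | k <;> simp_all
  · have h : ∃ k, (G.alice x).Adj a (some k) := ⟨k, huv⟩
    have hk := Option.some_injective _ (G.alice_unique x _ _ _ h.choose_spec huv)
    simp [next, aliceNext, h, hk]
  · have h : ∃ k, (G.bob y).Adj i k := ⟨j, huv⟩
    simp [next, bobNext, h, G.bob_unique y _ _ _ h.choose_spec huv]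

theorem next_eq_zero (h : ∀ w, (G.graph x y).Adj v w → (pipes s).Adj v w) :
    G.next x y v = 0 := by
  rcases v with a | i
  · exact dif_neg fun ⟨j, hj⟩ => not_pipes_adj_inl_inl (h (.inl (some j)) (by simpa using hj))
  · exact dif_neg fun ⟨j, hj⟩ => not_pipes_adj_inr_inr (h (.inr j) (by simpa using hj))

section Path

variable {p : (G.graph x y).Walk (tap s) v} {k : ℕ}

theorem pipes_adj_getVert_succ_iff_odd (hp : p.IsPath) (hk : k < p.length) :
    (pipes s).Adj (p.getVert k) (p.getVert (k + 1)) ↔ Odd k :=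
  AlternatingPath.adj_getVert_succ_iff_odd G.isAlternating_graph_pipes
    (fun _ => not_pipes_adj_tap) hp hk

theorem not_pipes_adj_getVert_two_mul (hp : p.IsPath) (hk : 2 * k < p.length) :
    ¬(pipes s).Adj (p.getVert (2 * k)) (p.getVert (2 * k + 1)) := by
  simp [pipes_adj_getVert_succ_iff_odd hp hk]

theorem pipes_adj_getVert_two_mul_add_one (hp : p.IsPath) (hk : 2 * k + 1 < p.length) :
    (pipes s).Adj (p.getVert (2 * k + 1)) (p.getVert (2 * (k + 1))) :=
  (pipes_adj_getVert_succ_iff_odd hp hk).2 (by simp)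

theorem isRight_getVert_two_mul (hp : p.IsPath) (hk : 2 * k ≤ p.length) :
    (p.getVert (2 * k)).isRight = k.bodd := by
  induction k with
  | zero => simp
  | succ k ih =>
    rw [Nat.bodd_succ, ← ih (by omega),
      isRight_of_pipes_adj (pipes_adj_getVert_two_mul_add_one hp (by omega)),
      isRight_of_graph_adj_of_not_pipes_adj (p.adj_getVert_succ (by omega))
        (not_pipes_adj_getVert_two_mul hp (by omega))]

theorem next_getVert_two_mul (hp : p.IsPath) (hk : 2 * k + 1 < p.length) :
    G.next x y (p.getVert (2 * k)) = vertexIndex (p.getVert (2 * (k + 1))) :=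
  next_eq_vertexIndex (p.adj_getVert_succ (by omega))
    (not_pipes_adj_getVert_two_mul hp (by omega)) (pipes_adj_getVert_two_mul_add_one hp hk)

theorem vertexIndex_getVert_ne_zero (hp : p.IsPath) (hk : 2 * k + 1 < p.length) :
    vertexIndex (p.getVert (2 * (k + 1))) ≠ 0 :=
  vertexIndex_ne_zero fun h =>
    not_pipes_adj_tap (h ▸ (pipes_adj_getVert_two_mul_add_one hp hk).symm)

end Path

theorem chase_eq_isRight_of_isEndpoint {next : ℕ → ℕ} {F : ℕ} (hF : s < F)
    (hnext : ∀ u, next (vertexIndex u) = G.next x y u) (hv : G.IsEndpoint x y v) :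
    PointerChasing.chase next F false 0 = v.isRight := by
  obtain ⟨p, hp, hmax⟩ := hv
  obtain ⟨⟨r, hr⟩, hpipes⟩ := AlternatingPath.even_length_and_forall_adj_of_forall_mem_support
    G.isAlternating_graph_pipes G.pipes_le_graph (fun _ => not_pipes_adj_tap)
    (fun _ => exists_pipes_adj) hp hmax
  have hrF : r < F := by
    have := hp.length_lt
    simp only [Fintype.card_sum, Fintype.card_option, Fintype.card_fin] at this
    omega
  have hlast : p.getVert (2 * r) = v := by rw [two_mul, ← hr, p.getVert_length]
  have hchase := PointerChasing.chase_eq_of_forall_lt (next := next) false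
    (i := fun k => vertexIndex (p.getVert (2 * k))) hrF
    (fun k hk => ⟨(hnext _).trans (next_getVert_two_mul hp (by omega)),
      vertexIndex_getVert_ne_zero hp (by omega)⟩)
    (by rw [hnext, hlast, next_eq_zero hpipes])
  rw [← hlast, isRight_getVert_two_mul hp (by omega)]
  simpa [vertexIndex] using hchase

variable (G)

/-- The pointers that Alice stores, in the order of `vertexIndex`. -/
noncomputable def aliceRow (x : Bits n) : List ℕ :=
  G.aliceNext x none :: List.ofFn fun i => G.aliceNext x (some i)

/-- The pointers that Bob stores, in the order of `vertexIndex`. -/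
noncomputable def bobRow (y : Bits n) : List ℕ := List.ofFn (G.bobNext y)

theorem length_aliceRow : (G.aliceRow x).length = s + 1 := by
  simp [aliceRow]

theorem length_bobRow : (G.bobRow y).length = s := by
  simp [bobRow]

theorem aliceNext_le (a : Option (Fin s)) : G.aliceNext x a ≤ 2 * s + 1 := by
  rw [aliceNext]
  split_ifs with h
  · have := h.choose.isLt
    simp only [vertexIndex]
    omega
  · exact Nat.zero_le _

theorem bobNext_le (i : Fin s) : G.bobNext y i ≤ s := by
  rw [bobNext]
  split_ifs with h
  · exact h.choose.isLt
  · exact Nat.zero_le _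

/-- The length of the players' codewords: in unary, the pointers and the marks that separate them
take at most `2 * (s + 1) ^ 2` bits on either side, and one bit is left for the padding. -/
def codeLength (s : ℕ) : ℕ := 2 * (s + 1) ^ 2 + 1

theorem sum_add_length_aliceRow_lt :
    (G.aliceRow x).sum + (G.aliceRow x).length < codeLength s := by
  have h : (G.aliceRow x).sum ≤ (G.aliceRow x).length • (2 * s + 1) :=
    List.sum_le_card_nsmul _ _ (by simp [aliceRow, List.mem_ofFn, aliceNext_le])
  rw [length_aliceRow, smul_eq_mul] at h
  rw [length_aliceRow, codeLength]
  linarith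

theorem sum_add_length_bobRow_lt :
    (G.bobRow y).sum + (G.bobRow y).length < codeLength s := by
  have h : (G.bobRow y).sum ≤ (G.bobRow y).length • s :=
    List.sum_le_card_nsmul _ _ (by simp [bobRow, List.mem_ofFn, bobNext_le])
  rw [length_bobRow, smul_eq_mul] at h
  rw [length_bobRow, codeLength]
  nlinarith

open PointerChasing

theorem pointer_paddedBlocks_vertexIndex {m : ℕ} (v : Option (Fin s) ⊕ Fin s) :
    pointer (paddedBlocks m (G.aliceRow x) ++ paddedBlocks m (G.bobRow y)) (vertexIndex v) =
      G.next x y v := by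
  rcases v with (_ | i) | j
  · rw [vertexIndex, pointer_paddedBlocks_append_left (by simp [length_aliceRow])]
    rfl
  · rw [vertexIndex, pointer_paddedBlocks_append_left (by simp [length_aliceRow])]
    simp [aliceRow, next]
  · have h := pointer_paddedBlocks_append_right (m := m) (D := G.aliceRow x) (E := G.bobRow y)
      (i := j) (by simp [length_bobRow])
    rw [length_aliceRow] at h
    simpa only [vertexIndex, next, Sum.elim_inr, bobRow, List.getElem_ofFn] using h

variable {G} in
theorem Computes.obtainedByLocalPreprocessing {f : Bits n → Bits n → Bool} (hG : G.Computes f) :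
    ObtainedByLocalPreprocessing f (pointerChase (codeLength s)) := by
  choose α hα using fun x =>
    exists_ofFn_eq (length_paddedBlocks (G.sum_add_length_aliceRow_lt (x := x)))
  choose β hβ using fun y =>
    exists_ofFn_eq (length_paddedBlocks (G.sum_add_length_bobRow_lt (y := y)))
  refine ⟨α, β, fun x y => ?_⟩
  obtain ⟨v, hv, hleft, hright⟩ := hG x y
  have hF : s < (List.ofFn (α x) ++ List.ofFn (β y)).length := by
    rw [List.length_append, List.length_ofFn, List.length_ofFn, codeLength]
    nlinarith
  have hnext (u) :
      pointer (List.ofFn (α x) ++ List.ofFn (β y)) (vertexIndex u) = G.next x y u := by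
    rw [hα, hβ, pointer_paddedBlocks_vertexIndex]
  rw [pointerChase, chase_eq_isRight_of_isEndpoint hF hnext hv]
  cases hf : f x y
  · have := hleft hf
    cases v <;> simp_all
  · exact (hright hf).symm

end GardenHoseGame

theorem exists_computes_of_gardenHoseComplexity_le {n b : ℕ} {f : Bits n → Bits n → Bool}
    (h : gardenHoseComplexity f ≤ b) : ∃ s ≤ b, ∃ G : GardenHoseGame n s, G.Computes f := by
  obtain ⟨_, ⟨s, G, hG, rfl⟩, hlt⟩ := sInf_lt_iff.1 (h.trans_lt ENat.natCast_lt_succ)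
  exact ⟨s, Nat.lt_succ_iff.1 (by exact_mod_cast hlt), G, hG⟩

theorem mainTheorem2 (f : ∀ n : ℕ, Bits n → Bits n → Bool)
    (hf : ∃ p : Polynomial ℕ, ∀ n : ℕ,
      gardenHoseComplexity (f n) ≤ ((p.eval n : ℕ) : ℕ∞)) :
    LogSpaceUpToLocalPreprocessing f := by
  obtain ⟨p, hp⟩ := hf
  choose s hs G hG using fun n => exists_computes_of_gardenHoseComplexity_le (hp n)
  refine ⟨fun n => GardenHoseGame.codeLength (s n), PointerChasing.pointerChase,
    ⟨2 * (p + 1) ^ 2 + 1, fun n => ?_⟩, PointerChasing.logSpaceComputable_pointerChase,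
    fun n => (hG n).obtainedByLocalPreprocessing⟩
  simp only [GardenHoseGame.codeLength, Polynomial.eval_add, Polynomial.eval_mul,
    Polynomial.eval_pow, Polynomial.eval_one, Polynomial.eval_ofNat]
  gcongr
  exact hs n
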